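/- Let $a>0$ and let $q:[-a,a]\to\mathbb{C}$ be continuous. Consider the Goursat problem $$\frac{\partial^2 H(u,v)}{\partial u\,\partial v}=q(u+v)H(u,v),\qquad H(u,0)=\frac12\int_0^u q(s)\,ds,\qquad H(0,v)=0,$$ on the square $|u|+|v|\le a$, where a solution is a function $H$ that is continuous on the closed square, such that $\partial_v H$ and $\partial_u\partial_v H$ exist in the open square and the equation holds there. This problem has exactly one solution $H$. Put $K(x,t)=H\big(\frac{x+t}{2},\frac{x-t}{2}\big)$ and, for $h\in\mathbb{C}$, $$\mathbf{K}(x,t;h)=\frac h2+K(x,t)+\frac h2\int_t^x\big(K(x,s)-K(x,-s)\big)\,ds,\qquad \mathbf{T}_h w(x)=w(x)+\int_{-x}^{x}\mathbf{K}(x,t;h)\,w(t)\,dt .$$ Then for all $h,\omega\in\mathbb{C}$ and every solution $v:[-a,a]\to\mathbb{C}$ of $v''+\omega^2v=0$ on $[-a,a]$, the function $u=\mathbf{T}_hv$ is a solution of $u''-q(x)u+\omega^2u=0$ on $[-a,a]$, and $$u(0)=v(0),\qquad u'(0)=v'(0)+h\,v(0).$$ (Derivatives at the end points $\pm a$ are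 one-sided.) -/

import Mathlib

open Set

noncomputable section

/-- `H` is a (classical) solution on the closed square `|u| + |v| ≤ a`, that is `|u + v| ≤ a` and
`|u - v| ≤ a`, of the Goursat problem
`∂²H/∂u∂v = q(u + v) H`, `H(u, 0) = (1/2) ∫₀ᵘ q(s) ds`, `H(0, v) = 0`:
it is continuous on the closed square and, in the open square, the derivatives `∂H/∂v` and
`∂/∂u (∂H/∂v)` exist and the equation holds. -/
structure IsGoursatSolution (a : ℝ) (q : ℝ → ℂ) (H : ℝ → ℝ → ℂ) : Prop where
  continuousOn : ContinuousOn (fun p : ℝ × ℝ => H p.1 p.2) {p : ℝ × ℝ | |p.1| + |p.2| ≤ a}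
  differentiableAt : ∀ u v : ℝ, |u| + |v| < a → DifferentiableAt ℝ (fun v' => H u v') v
  equation : ∀ u v : ℝ, |u| + |v| < a →
    HasDerivAt (fun u' => deriv (fun v' => H u' v') v) (q (u + v) * H u v) u
  initial_left : ∀ u : ℝ, |u| ≤ a → H u 0 = (1 / 2) * ∫ s in (0 : ℝ)..u, q s
  initial_right : ∀ v : ℝ, |v| ≤ a → H 0 v = 0

/-- The solution of the Goursat problem. -/
def goursatSolution (a : ℝ) (q : ℝ → ℂ) : ℝ → ℝ → ℂ :=
  Classical.epsilon (IsGoursatSolution a q)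

/-- The kernel `K(x, t) = H((x + t)/2, (x - t)/2)` of the operator `T`. -/
def kernelK (a : ℝ) (q : ℝ → ℂ) (x t : ℝ) : ℂ :=
  goursatSolution a q ((x + t) / 2) ((x - t) / 2)

/-- The kernel `K(x, t; h) = h/2 + K(x, t) + (h/2) ∫ₜˣ (K(x, s) - K(x, -s)) ds`. -/
def kernelKh (a : ℝ) (q : ℝ → ℂ) (h : ℂ) (x t : ℝ) : ℂ :=
  h / 2 + kernelK a q x t + h / 2 * ∫ s in t..x, (kernelK a q x s - kernelK a q x (-s))

/-- The operator `T_h w(x) = w(x) + ∫_{-x}^{x} K(x, t; h) w(t) dt`. -/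
def operatorTh (a : ℝ) (q : ℝ → ℂ) (h : ℂ) (w : ℝ → ℂ) (x : ℝ) : ℂ :=
  w x + ∫ t in (-x)..x, kernelKh a q h x t * w t

/-- `y` is a solution of `y'' - q(x) y + ω² y = 0` on the closed segment `[-a, a]`
(derivatives at the end points are one-sided). -/
def IsSchrodingerSolution (a : ℝ) (q : ℝ → ℂ) (ω : ℂ) (y : ℝ → ℂ) : Prop :=
  ∃ y' y'' : ℝ → ℂ, ∀ x ∈ Icc (-a) a,
    HasDerivWithinAt y (y' x) (Icc (-a) a) x ∧
    HasDerivWithinAt y' (y'' x) (Icc (-a) a) x ∧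
    y'' x - q x * y x + ω ^ 2 * y x = 0

end

section
open intervalIntegral MeasureTheory Filter Topology
open scoped Nat Interval

/-! Extend `q` to a bounded continuous function on the line. The Goursat problem then becomes the
Volterra equation H = f + ∫₀ᵛ∫₀ᵘ q(s + w)H(s, w) ds dw with f(u) = ½∫₀ᵘ q, solved on the whole plane
by its Neumann series (`exists_goursat_integralEquation`). Since the n-th iterate is bounded by
C(MR|v|)ⁿ/n!, the series converges; the same estimate forces the difference of two solutions to
vanish (`eq_of_isGoursatIntegralSolution`).

For the transmutation property, integration by parts moves the odd part of the kernel onto the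
function, so T_h v = T_0 y with y = v + (h/2)∫_{-x}^{x} v (`operatorTh_eq`). This y again satisfies
y'' = -ω²y, with y(0) = v(0) and y'(0) = v'(0) + h v(0). Writing T_0 y = y + A(y), it remains to
show A(y)'' = q y + q A(y) + A(y'') and A(y)(0) = A(y)'(0) = 0
(`exists_hasDerivAt_characteristicIntegral`): then u = T_0 y has u'' = y'' + q u + A(y'') = q u -
ω²u.

As `q` is only continuous, K need not be twice differentiable. In characteristic coordinates only
H_v and H_uv occur, and these exist. -/

/-! ### Neumann series for the Goursat integral equation. -/

/-- The Volterra operator of the Goursat problem, `F ↦ ∫₀ᵛ ∫₀ᵘ q(s + w) F(s, w) ds dw`. -/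
noncomputable def goursatIntegral (q : ℝ → ℂ) (F : ℝ → ℝ → ℂ) (u v : ℝ) : ℂ :=
  ∫ w in (0 : ℝ)..v, ∫ s in (0 : ℝ)..u, q (s + w) * F s w

/-- The terms of the Neumann series of the Goursat integral equation. -/
noncomputable def goursatIterate (q f : ℝ → ℂ) : ℕ → ℝ → ℝ → ℂ
  | 0 => fun u _ => f u
  | n + 1 => goursatIntegral q (goursatIterate q f n)

theorem abs_le_of_mem_uIoc_zero {s u : ℝ} (hs : s ∈ Ι 0 u) : |s| ≤ |u| := by
  rcases le_total 0 u with h | h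
  · rw [uIoc_of_le h] at hs
    rw [abs_of_pos hs.1, abs_of_nonneg h]; exact hs.2
  · rw [uIoc_of_ge h] at hs
    rw [abs_of_nonpos hs.2, abs_of_nonpos h]; linarith [hs.1]

theorem continuous_goursatInner {q : ℝ → ℂ} (hq : Continuous q) {F : ℝ → ℝ → ℂ}
    (hF : Continuous fun p : ℝ × ℝ => F p.1 p.2) :
    Continuous fun p : ℝ × ℝ => ∫ s in (0 : ℝ)..p.1, q (s + p.2) * F s p.2 := by
  have h := continuous_parametric_primitive_of_continuous (μ := volume) (a₀ := 0)
    (f := fun w s => q (s + w) * F s w)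
    ((hq.comp (continuous_snd.add continuous_fst)).mul (hF.comp continuous_swap))
  exact h.comp continuous_swap

theorem continuous_goursatIntegral {q : ℝ → ℂ} (hq : Continuous q) {F : ℝ → ℝ → ℂ}
    (hF : Continuous fun p : ℝ × ℝ => F p.1 p.2) :
    Continuous fun p : ℝ × ℝ => goursatIntegral q F p.1 p.2 :=
  continuous_parametric_primitive_of_continuous (μ := volume) (a₀ := 0)
    (f := fun u w => ∫ s in (0 : ℝ)..u, q (s + w) * F s w) (continuous_goursatInner hq hF)

/-- The u-integration costs a factor R, while the v-integration raises the power of |v| and supplies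
the factorial. Only values of `F` on the rectangle |s| ≤ |u|, |w| ≤ |v| enter, so the estimate also
iterates inside the square, where uniqueness needs it. -/
theorem norm_goursatIntegral_le {q : ℝ → ℂ} {M C R : ℝ} (hM : 0 ≤ M) (hC : 0 ≤ C)
    (hq : ∀ x, ‖q x‖ ≤ M) {F : ℝ → ℝ → ℂ} {u v : ℝ} (hu : |u| ≤ R) (n : ℕ)
    (hF : ∀ s w, |s| ≤ |u| → |w| ≤ |v| → ‖F s w‖ ≤ C * (M * R * |w|) ^ n / n !) :
    ‖goursatIntegral q F u v‖ ≤ C * (M * R * |v|) ^ (n + 1) / (n + 1)! := by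
  have hR : 0 ≤ R := (abs_nonneg u).trans hu
  have hinner : ∀ w ∈ Ι 0 v, ‖∫ s in (0 : ℝ)..u, q (s + w) * F s w‖
      ≤ (C * (M * R) ^ (n + 1) / n !) * |w - 0| ^ n := by
    intro w hw
    have h1 : ∀ s ∈ Ι 0 u, ‖q (s + w) * F s w‖ ≤ M * (C * (M * R * |w|) ^ n / n !) := by
      intro s hs
      rw [norm_mul]
      exact mul_le_mul (hq _) (hF s w (abs_le_of_mem_uIoc_zero hs) (abs_le_of_mem_uIoc_zero hw))
        (norm_nonneg _) hM
    refine (norm_integral_le_of_norm_le_const h1).trans ?_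
    rw [sub_zero, sub_zero]
    calc M * (C * (M * R * |w|) ^ n / n !) * |u| ≤ M * (C * (M * R * |w|) ^ n / n !) * R := by
          gcongr
      _ = (C * (M * R) ^ (n + 1) / n !) * |w| ^ n := by rw [mul_pow]; ring
  have hint : IntervalIntegrable (fun w : ℝ => (C * (M * R) ^ (n + 1) / n !) * |w - 0| ^ n)
      volume 0 v := (by fun_prop : Continuous _).intervalIntegrable _ _
  refine (norm_integral_le_abs_of_norm_le
    ((ae_restrict_iff' measurableSet_uIoc).2 (ae_of_all _ hinner)) hint).trans_eq ?_
  rw [abs_intervalIntegral_eq, MeasureTheory.integral_const_mul, integral_pow_abs_sub_uIoc, sub_zero,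
    abs_of_nonneg (by positivity), Nat.factorial_succ, mul_pow _ |v|]
  push_cast
  field_simp

theorem continuous_goursatIterate {q f : ℝ → ℂ} (hq : Continuous q) (hf : Continuous f) (n : ℕ) :
    Continuous fun p : ℝ × ℝ => goursatIterate q f n p.1 p.2 := by
  induction n with
  | zero => exact hf.comp continuous_fst
  | succ n ih => exact continuous_goursatIntegral hq ih

theorem norm_goursatIterate_le {q f : ℝ → ℂ} {M C R : ℝ} (hM : 0 ≤ M) (hC : 0 ≤ C)
    (hq : ∀ x, ‖q x‖ ≤ M) (hf : ∀ u, |u| ≤ R → ‖f u‖ ≤ C) (n : ℕ) (u v : ℝ) (hu : |u| ≤ R) :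
    ‖goursatIterate q f n u v‖ ≤ C * (M * R * |v|) ^ n / n ! := by
  induction n generalizing u v with
  | zero => simpa [goursatIterate] using hf u hu
  | succ n ih => exact norm_goursatIntegral_le hM hC hq hu n fun s w hs _ => ih s w (hs.trans hu)

/-- The Goursat integral equation has a continuous solution on the whole plane. -/
theorem exists_goursat_integralEquation {q f : ℝ → ℂ} {M : ℝ} (hM : 0 ≤ M)
    (hq : Continuous q) (hqM : ∀ x, ‖q x‖ ≤ M) (hf : Continuous f) :
    ∃ H : ℝ → ℝ → ℂ, (Continuous fun p : ℝ × ℝ => H p.1 p.2) ∧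
      ∀ u v, H u v = f u + goursatIntegral q H u v := by
  have hG := continuous_goursatIterate hq hf
  -- A summable majorant on each square serves both for local uniform convergence and for
  -- integrating the series term by term.
  have key : ∀ R : ℝ, ∃ b : ℕ → ℝ, Summable b ∧
      ∀ n u v, |u| ≤ R → |v| ≤ R → ‖goursatIterate q f n u v‖ ≤ b n := by
    intro R
    obtain ⟨C, hC⟩ := (isCompact_Icc (a := -R) (b := R)).exists_bound_of_continuousOn
      hf.continuousOn
    refine ⟨fun n => max C 0 * ((M * R * R) ^ n / n !),
      (Real.summable_pow_div_factorial _).mul_left _, fun n u v hu hv => ?_⟩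
    have hR : 0 ≤ R := (abs_nonneg u).trans hu
    refine (norm_goursatIterate_le hM (le_max_right C 0) hqM
      (fun u hu => (hC u (abs_le.1 hu)).trans (le_max_left _ _)) n u v hu).trans ?_
    rw [mul_div_assoc]
    have : M * R * |v| ≤ M * R * R := by gcongr
    beta_reduce
    gcongr
  have hsum : ∀ u v, Summable fun n => goursatIterate q f n u v := by
    intro u v
    obtain ⟨b, hb, hle⟩ := key (max |u| |v|)
    exact hb.of_norm_bounded fun n => hle n u v (le_max_left _ _) (le_max_right _ _)
  refine ⟨fun u v => ∑' n, goursatIterate q f n u v, ?_, fun u v => ?_⟩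
  · rw [continuous_iff_continuousAt]
    rintro ⟨u, v⟩
    -- The margin 1 makes the square a neighbourhood of (u, v).
    obtain ⟨b, hb, hle⟩ := key (max |u| |v| + 1)
    have hu := le_max_left |u| |v|
    have hv := le_max_right |u| |v|
    set R := max |u| |v| + 1
    have hs : {p : ℝ × ℝ | |p.1| < R} ∩ {p : ℝ × ℝ | |p.2| < R} ∈ 𝓝 (u, v) :=
      ((isOpen_lt (by fun_prop) (by fun_prop)).inter
        (isOpen_lt (by fun_prop) (by fun_prop))).mem_nhds
        ⟨show |u| < R by linarith, show |v| < R by linarith⟩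
    exact (continuousOn_tsum (fun n => (hG n).continuousOn) hb
      fun n p hp => hle n p.1 p.2 (le_of_lt hp.1) (le_of_lt hp.2)).continuousAt hs
  · obtain ⟨b, hb, hle⟩ := key (max |u| |v|)
    have hinner : ∀ w ∈ Ι 0 v, HasSum
        (fun n => ∫ s in (0 : ℝ)..u, q (s + w) * goursatIterate q f n s w)
        (∫ s in (0 : ℝ)..u, q (s + w) * ∑' n, goursatIterate q f n s w) := by
      intro w hw
      refine hasSum_integral_of_dominated_convergence (fun n _ => M * b n) (fun n => ?_)
        (fun n => ae_of_all _ fun s hs => ?_) (ae_of_all _ fun _ _ => hb.mul_left M)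
        intervalIntegrable_const (ae_of_all _ fun s _ => (hsum s w).hasSum.mul_left _)
      · have : Continuous fun s => q (s + w) * goursatIterate q f n s w :=
          (by fun_prop : Continuous fun s => q (s + w)).mul
            ((hG n).comp (by fun_prop : Continuous fun s : ℝ => (s, w)))
        exact this.aestronglyMeasurable
      · rw [norm_mul]
        exact mul_le_mul (hqM _) (hle n s w ((abs_le_of_mem_uIoc_zero hs).trans (le_max_left _ _))
          ((abs_le_of_mem_uIoc_zero hw).trans (le_max_right _ _))) (norm_nonneg _) hM
    have houter : HasSum (fun n => goursatIterate q f (n + 1) u v)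
        (goursatIntegral q (fun u v => ∑' n, goursatIterate q f n u v) u v) := by
      refine hasSum_integral_of_dominated_convergence (fun n _ => M * b n * |u - 0|) (fun n => ?_)
        (fun n => ae_of_all _ fun w hw => ?_)
        (ae_of_all _ fun _ _ => (hb.mul_left M).mul_right _)
        intervalIntegrable_const (ae_of_all _ hinner)
      · exact ((continuous_goursatInner hq (hG n)).comp
          (by fun_prop : Continuous fun w : ℝ => (u, w))).aestronglyMeasurable
      · refine norm_integral_le_of_norm_le_const fun s hs => ?_
        rw [norm_mul]
        exact mul_le_mul (hqM _) (hle n s w ((abs_le_of_mem_uIoc_zero hs).trans (le_max_left _ _))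
          ((abs_le_of_mem_uIoc_zero hw).trans (le_max_right _ _))) (norm_nonneg _) hM
    rw [← houter.tsum_eq]
    exact (hsum u v).tsum_eq_zero_add

/-! ### Solutions of the integral equation solve the Goursat problem. -/

theorem hasDerivAt_goursatIntegral {q : ℝ → ℂ} (hq : Continuous q) {F : ℝ → ℝ → ℂ}
    (hF : Continuous fun p : ℝ × ℝ => F p.1 p.2) (u v : ℝ) :
    HasDerivAt (fun v => goursatIntegral q F u v) (∫ s in (0 : ℝ)..u, q (s + v) * F s v) v :=
  (((continuous_goursatInner hq hF).comp
    (by fun_prop : Continuous fun w : ℝ => (u, w))).integral_hasStrictDerivAt 0 v).hasDerivAt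

/-- `H` is a continuous solution on the whole plane of the integral equation
`H(u, v) = (1/2) ∫₀ᵘ q + ∫₀ᵛ ∫₀ᵘ q(s + w) H(s, w) ds dw`. -/
def IsGoursatIntegralSolution (q : ℝ → ℂ) (H : ℝ → ℝ → ℂ) : Prop :=
  (Continuous fun p : ℝ × ℝ => H p.1 p.2) ∧
    ∀ u v, H u v = 1 / 2 * (∫ s in (0 : ℝ)..u, q s) + goursatIntegral q H u v

/-- Extension by the endpoint values. It frees all later integrals and derivatives from domain
conditions. -/
theorem exists_bounded_continuous_extension {a : ℝ} (ha : 0 ≤ a) {q : ℝ → ℂ}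
    (hq : ContinuousOn q (Icc (-a) a)) :
    ∃ Q : ℝ → ℂ, Continuous Q ∧ EqOn Q q (Icc (-a) a) ∧ ∃ M, 0 ≤ M ∧ ∀ x, ‖Q x‖ ≤ M := by
  have haa : -a ≤ a := by linarith
  obtain ⟨M, hM⟩ := isCompact_Icc.exists_bound_of_continuousOn hq
  refine ⟨IccExtend haa ((Icc (-a) a).domRestrict q),
    continuous_IccExtend_iff.2 (continuousOn_iff_continuous_domRestrict.1 hq),
    fun x hx => IccExtend_of_mem haa _ hx, M,
    (norm_nonneg _).trans (hM a (right_mem_Icc.2 haa)), fun x => ?_⟩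
  exact hM _ (projIcc (-a) a haa x).2

theorem add_mem_Icc_of_abs_le {a u v s w : ℝ} (h : |u| + |v| ≤ a) (hs : |s| ≤ |u|)
    (hw : |w| ≤ |v|) : s + w ∈ Icc (-a) a :=
  abs_le.1 ((abs_add_le s w).trans ((add_le_add hs hw).trans h))

theorem abs_le_of_mem_uIcc_zero {s u : ℝ} (hs : s ∈ uIcc 0 u) : |s| ≤ |u| := by
  rcases le_total 0 u with h | h
  · rw [uIcc_of_le h] at hs
    rw [abs_of_nonneg hs.1, abs_of_nonneg h]; exact hs.2
  · rw [uIcc_of_ge h] at hs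
    rw [abs_of_nonpos hs.2, abs_of_nonpos h]; linarith [hs.1]

namespace IsGoursatIntegralSolution

variable {q : ℝ → ℂ} {H : ℝ → ℝ → ℂ}

theorem hasDerivAt_snd (h : IsGoursatIntegralSolution q H) (hq : Continuous q) (u v : ℝ) :
    HasDerivAt (fun v => H u v) (∫ s in (0 : ℝ)..u, q (s + v) * H s v) v := by
  have := (hasDerivAt_goursatIntegral hq h.1 u v).const_add (1 / 2 * (∫ s in (0 : ℝ)..u, q s))
  exact this.congr_of_eventuallyEq (Eventually.of_forall fun v => h.2 u v)

theorem hasDerivAt_fst_deriv (h : IsGoursatIntegralSolution q H) (hq : Continuous q) (u v : ℝ) :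
    HasDerivAt (fun u => ∫ s in (0 : ℝ)..u, q (s + v) * H s v) (q (u + v) * H u v) u := by
  have : Continuous fun s => q (s + v) * H s v :=
    (by fun_prop : Continuous fun s => q (s + v)).mul
      (h.1.comp (by fun_prop : Continuous fun s : ℝ => (s, v)))
  exact (this.integral_hasStrictDerivAt 0 u).hasDerivAt

theorem apply_zero_right (h : IsGoursatIntegralSolution q H) (u : ℝ) :
    H u 0 = 1 / 2 * ∫ s in (0 : ℝ)..u, q s := by
  rw [h.2]; simp [goursatIntegral]

theorem apply_zero_left (h : IsGoursatIntegralSolution q H) (v : ℝ) : H 0 v = 0 := by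
  rw [h.2]; simp [goursatIntegral]

theorem isGoursatSolution (h : IsGoursatIntegralSolution q H) (hq : Continuous q) {a : ℝ}
    {p : ℝ → ℂ} (hqp : EqOn q p (Icc (-a) a)) : IsGoursatSolution a p H where
  continuousOn := h.1.continuousOn
  differentiableAt u v _ := (h.hasDerivAt_snd hq u v).differentiableAt
  equation u v huv := by
    rw [← hqp (add_mem_Icc_of_abs_le huv.le le_rfl le_rfl)]
    simp only [fun u => (h.hasDerivAt_snd hq u v).deriv]
    exact h.hasDerivAt_fst_deriv hq u v
  initial_left u hu := by
    rw [h.apply_zero_right]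
    congr 1
    exact integral_congr fun s hs =>
      hqp (abs_le.1 ((abs_le_of_mem_uIcc_zero hs).trans hu))
  initial_right v _ := h.apply_zero_left v

end IsGoursatIntegralSolution

/-! ### Uniqueness for the Goursat problem. -/

namespace IsGoursatSolution

/-- Integrate the equation in u from the edge u = 0, where H vanishes and hence so does H_v. The
global extension `H'` makes the integrand continuous. -/
theorem deriv_eq_integral {a : ℝ} {q Q : ℝ → ℂ} (hQ : Continuous Q)
    (hQq : EqOn Q q (Icc (-a) a)) {H : ℝ → ℝ → ℂ} (h : IsGoursatSolution a q H)
    {H' : ℝ → ℝ → ℂ} (hc : Continuous fun p : ℝ × ℝ => H' p.1 p.2)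
    (hH : ∀ u v, |u| + |v| ≤ a → H' u v = H u v) {u v : ℝ} (huv : |u| + |v| < a) :
    deriv (fun v' => H u v') v = ∫ s in (0 : ℝ)..u, Q (s + v) * H' s v := by
  have hv : |v| < a := by linarith [abs_nonneg u]
  have h0 : deriv (fun v' => H 0 v') v = 0 := by
    have : (fun v' => H 0 v') =ᶠ[𝓝 v] fun _ => 0 := by
      filter_upwards [(isOpen_lt continuous_abs continuous_const).mem_nhds hv] with w hw
      exact h.initial_right w (le_of_lt hw)
    rw [this.deriv_eq, deriv_const]
  have hcs : Continuous fun s => Q (s + v) * H' s v :=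
    (by fun_prop : Continuous fun s => Q (s + v)).mul
      (hc.comp (by fun_prop : Continuous fun s : ℝ => (s, v)))
  have := integral_eq_sub_of_hasDerivAt (a := 0) (b := u)
    (f := fun u' => deriv (fun v' => H u' v') v) (f' := fun s => Q (s + v) * H' s v)
    (fun s hs => by
      have hs' := abs_le_of_mem_uIcc_zero hs
      have hsv : |s| + |v| < a := by linarith
      rw [hQq (add_mem_Icc_of_abs_le hsv.le le_rfl le_rfl), hH s v hsv.le]
      exact h.equation s v hsv) (hcs.intervalIntegrable _ _)
  rw [this, h0, sub_zero]

theorem eq_add_goursatIntegral {a : ℝ} {q Q : ℝ → ℂ} (hQ : Continuous Q)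
    (hQq : EqOn Q q (Icc (-a) a)) {H : ℝ → ℝ → ℂ} (h : IsGoursatSolution a q H)
    {H' : ℝ → ℝ → ℂ} (hc : Continuous fun p : ℝ × ℝ => H' p.1 p.2)
    (hH : ∀ u v, |u| + |v| ≤ a → H' u v = H u v) {u v : ℝ} (huv : |u| + |v| < a) :
    H u v = 1 / 2 * (∫ s in (0 : ℝ)..u, Q s) + goursatIntegral Q H' u v := by
  have hu : |u| < a := by linarith [abs_nonneg v]
  have hcw := (continuous_goursatInner hQ hc).comp (by fun_prop : Continuous fun w : ℝ => (u, w))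
  have := integral_eq_sub_of_hasDerivAt (a := 0) (b := v)
    (f := fun v' => H u v') (f' := fun w => ∫ s in (0 : ℝ)..u, Q (s + w) * H' s w)
    (fun w hw => by
      have hw' := abs_le_of_mem_uIcc_zero hw
      have huw : |u| + |w| < a := by linarith
      rw [← h.deriv_eq_integral hQ hQq hc hH huw]
      exact (h.differentiableAt u w huw).hasDerivAt) (hcw.intervalIntegrable _ _)
  rw [goursatIntegral, this, h.initial_left u hu.le]
  have : ∫ s in (0 : ℝ)..u, Q s = ∫ s in (0 : ℝ)..u, q s := integral_congr fun s hs =>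
      hQq (abs_le.1 ((abs_le_of_mem_uIcc_zero hs).trans hu.le))
  rw [this]
  ring

theorem eq_of_isGoursatIntegralSolution {a M : ℝ} (ha : 0 < a) {q Q : ℝ → ℂ} (hQ : Continuous Q)
    (hQq : EqOn Q q (Icc (-a) a)) (hM : 0 ≤ M) (hQM : ∀ x, ‖Q x‖ ≤ M) {H G : ℝ → ℝ → ℂ}
    (h : IsGoursatSolution a q H) (hG : IsGoursatIntegralSolution Q G) {u v : ℝ}
    (huv : |u| + |v| ≤ a) : H u v = G u v := by
  have hclosed : IsClosed {p : ℝ × ℝ | |p.1| + |p.2| ≤ a} :=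
    isClosed_le (by fun_prop) continuous_const
  -- Tietze extension from the closed square to the plane.
  obtain ⟨H', hH'⟩ := ContinuousMap.exists_restrict_eq hclosed
    ⟨_, continuousOn_iff_continuous_domRestrict.1 h.continuousOn⟩
  have hH : ∀ u v, |u| + |v| ≤ a → H' (u, v) = H u v := fun u v huv =>
    DFunLike.congr_fun hH' (⟨(u, v), huv⟩ : {p : ℝ × ℝ | |p.1| + |p.2| ≤ a})
  have hc : Continuous fun p : ℝ × ℝ => (fun u v => H' (u, v)) p.1 p.2 := H'.continuous
  have hDc : Continuous fun p : ℝ × ℝ => (fun u v => H' (u, v) - G u v) p.1 p.2 := hc.sub hG.1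
  have hD : ∀ u v, |u| + |v| < a →
      H' (u, v) - G u v = goursatIntegral Q (fun u v => H' (u, v) - G u v) u v := by
    intro u v huv
    rw [hH u v huv.le, h.eq_add_goursatIntegral hQ hQq hc hH huv, hG.2 u v, add_sub_add_left_eq_sub]
    have hi : ∀ {F : ℝ → ℝ → ℂ}, (Continuous fun p : ℝ × ℝ => F p.1 p.2) → ∀ w,
        IntervalIntegrable (fun s => Q (s + w) * F s w) volume 0 u := fun {F} hF w =>
      ((by fun_prop : Continuous fun s => Q (s + w)).mul
        (hF.comp (by fun_prop : Continuous fun s : ℝ => (s, w)))).intervalIntegrable _ _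
    have ho : ∀ {F : ℝ → ℝ → ℂ}, (Continuous fun p : ℝ × ℝ => F p.1 p.2) →
        IntervalIntegrable (fun w => ∫ s in (0 : ℝ)..u, Q (s + w) * F s w) volume 0 v :=
      fun {F} hF => ((continuous_goursatInner hQ hF).comp
        (by fun_prop : Continuous fun w : ℝ => (u, w))).intervalIntegrable _ _
    unfold goursatIntegral
    rw [← integral_sub (ho (F := fun u v => H' (u, v)) hc) (ho hG.1)]
    congr 1 with w
    rw [← integral_sub (hi (F := fun u v => H' (u, v)) hc w) (hi hG.1 w)]
    simp only [mul_sub]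
  have hcompact : IsCompact {p : ℝ × ℝ | |p.1| + |p.2| ≤ a} := by
    refine (isCompact_Icc (a := ((-a, -a) : ℝ × ℝ)) (b := (a, a))).of_isClosed_subset hclosed
      fun p (hp : |p.1| + |p.2| ≤ a) => ?_
    have h1 := abs_le.1 (show |p.1| ≤ a by linarith [abs_nonneg p.2])
    have h2 := abs_le.1 (show |p.2| ≤ a by linarith [abs_nonneg p.1])
    exact ⟨⟨h1.1, h2.1⟩, ⟨h1.2, h2.2⟩⟩
  obtain ⟨B, hB⟩ := hcompact.exists_bound_of_continuousOn hDc.continuousOn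
  have hB0 : 0 ≤ B := (norm_nonneg _).trans (hB (0, 0) (by simpa using ha.le))
  have hbound : ∀ (n : ℕ) (u v : ℝ), |u| + |v| < a →
      ‖H' (u, v) - G u v‖ ≤ B * (M * a * |v|) ^ n / n ! := by
    intro n
    induction n with
    | zero => intro u v huv; simpa using hB (u, v) huv.le
    | succ n ih =>
      intro u v huv
      rw [hD u v huv]
      exact norm_goursatIntegral_le hM hB0 hQM (by linarith [abs_nonneg v]) n
        fun s w hs hw => ih s w (by linarith)
  have hzero : ∀ u v, |u| + |v| < a → H' (u, v) - G u v = 0 := by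
    intro u v huv
    rw [← norm_le_zero_iff]
    have hlim : Tendsto (fun n : ℕ => B * (M * a * |v|) ^ n / n !) atTop (𝓝 0) := by
      simpa [mul_div_assoc] using
        (FloorSemiring.tendsto_pow_div_factorial_atTop (M * a * |v|)).const_mul B
    exact ge_of_tendsto' hlim fun n => hbound n u v huv
  -- The equation holds only in the open square; boundary points are reached along the ray from the
  -- origin.
  have hray : Continuous fun t : ℝ => H' (t * u, t * v) - G (t * u) (t * v) :=
    hDc.comp (by fun_prop : Continuous fun t : ℝ => (t * u, t * v))
  have hlim : Tendsto (fun t : ℝ => H' (t * u, t * v) - G (t * u) (t * v)) (𝓝[<] 1)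
      (𝓝 (H' (u, v) - G u v)) := by
    simpa using (hray.tendsto 1).mono_left nhdsWithin_le_nhds
  have hev : (fun t : ℝ => H' (t * u, t * v) - G (t * u) (t * v)) =ᶠ[𝓝[<] 1] fun _ => 0 := by
    filter_upwards [Ioo_mem_nhdsLT (zero_lt_one' ℝ)] with t ht
    refine hzero _ _ ?_
    rw [abs_mul, abs_mul, abs_of_pos ht.1, ← mul_add]
    nlinarith [ht.1, ht.2]
  have := tendsto_nhds_unique hlim (tendsto_const_nhds.congr' hev.symm)
  rw [← hH u v huv]
  exact sub_eq_zero.1 this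

end IsGoursatSolution

theorem exists_isGoursatIntegralSolution {q : ℝ → ℂ} {M : ℝ} (hM : 0 ≤ M)
    (hq : Continuous q) (hqM : ∀ x, ‖q x‖ ≤ M) : ∃ H, IsGoursatIntegralSolution q H :=
  exists_goursat_integralEquation hM hq hqM
    (continuous_const.mul (continuous_primitive (fun _ _ => hq.intervalIntegrable _ _) 0))

/-! ### Differentiating the transmutation integral. -/

/-- Leibniz's rule for an integral with variable upper bound. -/
theorem hasDerivAt_integral_upper {F F' : ℝ → ℝ → ℂ}
    (hF : Continuous fun p : ℝ × ℝ => F p.1 p.2) (hF' : Continuous fun p : ℝ × ℝ => F' p.1 p.2)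
    (hd : ∀ x s, HasDerivAt (fun x => F x s) (F' x s) x) (x : ℝ) :
    HasDerivAt (fun x => ∫ s in (0 : ℝ)..x, F x s) (F x x + ∫ s in (0 : ℝ)..x, F' x s) x := by
  have hFs : ∀ y, Continuous (F y) := fun y =>
    hF.comp (by fun_prop : Continuous fun s : ℝ => (y, s))
  have hF's : ∀ y, Continuous (F' y) := fun y =>
    hF'.comp (by fun_prop : Continuous fun s : ℝ => (y, s))
  have hfix : HasDerivAt (fun y => ∫ s in (0 : ℝ)..x, F y s) (∫ s in (0 : ℝ)..x, F' x s) x := by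
    obtain ⟨C, hC⟩ := ((isCompact_Icc (a := x - 1) (b := x + 1)).prod
      (isCompact_uIcc (a := (0 : ℝ)) (b := x))).exists_bound_of_continuousOn hF'.continuousOn
    exact (hasDerivAt_integral_of_dominated_loc_of_deriv_le (μ := volume) (bound := fun _ => C)
      (Icc_mem_nhds (by linarith) (by linarith) : Icc (x - 1) (x + 1) ∈ 𝓝 x)
      (Eventually.of_forall fun y => (hFs y).aestronglyMeasurable)
      ((hFs x).intervalIntegrable _ _) (hF's x).aestronglyMeasurable
      (ae_of_all _ fun s hs y hy => hC (y, s) ⟨hy, uIoc_subset_uIcc hs⟩)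
      intervalIntegrable_const (ae_of_all _ fun s _ y _ => hd y s)).2
  -- By joint continuity at (x, x), the integrand stays within ε of `F x x` between x and y.
  have hvar : HasDerivAt (fun y => ∫ s in x..y, F y s) (F x x) x := by
    rw [hasDerivAt_iff_isLittleO, Asymptotics.isLittleO_iff]
    intro ε hε
    obtain ⟨δ, hδ, hball⟩ := Metric.continuousAt_iff.1 (hF.continuousAt (x := (x, x))) ε hε
    filter_upwards [Metric.ball_mem_nhds x hδ] with y hy
    have hconst : (y - x) • F x x = ∫ s in x..y, F x x := by simp
    rw [integral_same, sub_zero, hconst, ← integral_sub ((hFs y).intervalIntegrable _ _)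
      intervalIntegrable_const, Real.norm_eq_abs]
    refine norm_integral_le_of_norm_le_const fun s hs => ?_
    have hs' : |s - x| ≤ |y - x| := abs_sub_left_of_mem_uIcc (uIoc_subset_uIcc hs)
    have := hball (x := (y, s)) (by
      rw [Prod.dist_eq, max_lt_iff]
      exact ⟨hy, lt_of_le_of_lt hs' hy⟩)
    rw [dist_eq_norm] at this
    exact this.le
  have hsplit : (fun y => ∫ s in (0 : ℝ)..y, F y s) =
      fun y => (∫ s in x..y, F y s) + ∫ s in (0 : ℝ)..x, F y s := by
    ext y
    rw [add_comm]
    exact (integral_add_adjacent_intervals ((hFs y).intervalIntegrable _ _)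
      ((hFs y).intervalIntegrable _ _)).symm
  rw [hsplit]
  exact hvar.add hfix

/-- The integral part `∫_{-x}^{x} H((x + t)/2, (x - t)/2) w(t) dt` of the transmutation operator,
in characteristic coordinates. -/
noncomputable def characteristicIntegral (H : ℝ → ℝ → ℂ) (w : ℝ → ℂ) (x : ℝ) : ℂ :=
  2 * ∫ s in (0 : ℝ)..x, H s (x - s) * w (2 * s - x)

theorem integral_characteristic (H : ℝ → ℝ → ℂ) (w : ℝ → ℂ) (x : ℝ) :
    ∫ t in (-x)..x, H ((x + t) / 2) ((x - t) / 2) * w t = characteristicIntegral H w x := by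
  have h := smul_integral_comp_mul_sub (a := 0) (b := x)
    (fun t => H ((x + t) / 2) ((x - t) / 2) * w t) 2 x
  rw [show (2 : ℝ) * 0 - x = -x by ring, show 2 * x - x = x by ring, Complex.real_smul,
    Complex.ofReal_ofNat] at h
  rw [← h, characteristicIntegral]
  congr 2 with s
  congr 2 <;> ring

namespace IsGoursatIntegralSolution

variable {q : ℝ → ℂ} {H : ℝ → ℝ → ℂ}

/-- With s fixed, x enters H only through its second argument, so only H_v is needed. The moving
endpoint contributes H(x, 0)w(x). -/
theorem hasDerivAt_integral_mul (h : IsGoursatIntegralSolution q H) (hq : Continuous q)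
    {w w' : ℝ → ℂ} (hw : ∀ x, HasDerivAt w (w' x) x) (hw' : Continuous w') (x : ℝ) :
    HasDerivAt (fun x => ∫ s in (0 : ℝ)..x, H s (x - s) * w (2 * s - x))
      (H x 0 * w x + ((∫ s in (0 : ℝ)..x,
        (∫ r in (0 : ℝ)..s, q (r + (x - s)) * H r (x - s)) * w (2 * s - x)) -
        ∫ s in (0 : ℝ)..x, H s (x - s) * w' (2 * s - x))) x := by
  have hwc : Continuous w := continuous_iff_continuousAt.2 fun x => (hw x).continuousAt
  have hmap : Continuous fun p : ℝ × ℝ => (p.2, p.1 - p.2) := by fun_prop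
  have hc1 : Continuous fun p : ℝ × ℝ => H p.2 (p.1 - p.2) * w (2 * p.2 - p.1) :=
    (h.1.comp hmap).mul (by fun_prop)
  have hc2 : Continuous fun p : ℝ × ℝ =>
      (∫ r in (0 : ℝ)..p.2, q (r + (p.1 - p.2)) * H r (p.1 - p.2)) * w (2 * p.2 - p.1) :=
    ((continuous_goursatInner hq h.1).comp hmap).mul (by fun_prop)
  have hc3 : Continuous fun p : ℝ × ℝ => H p.2 (p.1 - p.2) * w' (2 * p.2 - p.1) :=
    (h.1.comp hmap).mul (by fun_prop)
  have hx : Continuous fun s : ℝ => (x, s) := by fun_prop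
  have key := hasDerivAt_integral_upper (F := fun x s => H s (x - s) * w (2 * s - x))
    (F' := fun x s => (∫ r in (0 : ℝ)..s, q (r + (x - s)) * H r (x - s)) * w (2 * s - x) -
      H s (x - s) * w' (2 * s - x)) hc1 (hc2.sub hc3) (fun x s => by
        have h1 := (h.hasDerivAt_snd hq s (x - s)).comp_sub_const x s
        have h2 := (hw (2 * s - x)).comp_const_sub (2 * s) x
        convert! h1.mul h2 using 1
        ring) x
  have hsub := integral_sub (μ := volume) ((hc2.comp hx).intervalIntegrable 0 x)
    ((hc3.comp hx).intervalIntegrable 0 x)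
  simp only [Function.comp_def] at hsub
  rw [← hsub]
  simpa only [sub_self, two_mul, add_sub_cancel_right] using key

/-- The substitution s ↦ x - s moves x into the first argument of H_v, so that only H_uv is needed.
On the line u + v = x the coefficient is q(x) and leaves the integral; the endpoint term vanishes
because H_v(0, x) = 0. -/
theorem hasDerivAt_integral_deriv_mul (h : IsGoursatIntegralSolution q H) (hq : Continuous q)
    {w w' : ℝ → ℂ} (hw : ∀ x, HasDerivAt w (w' x) x) (hw' : Continuous w') (x : ℝ) :
    HasDerivAt (fun x => ∫ s in (0 : ℝ)..x,
        (∫ r in (0 : ℝ)..s, q (r + (x - s)) * H r (x - s)) * w (2 * s - x))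
      (q x * (∫ s in (0 : ℝ)..x, H s (x - s) * w (2 * s - x)) + ∫ s in (0 : ℝ)..x,
        (∫ r in (0 : ℝ)..s, q (r + (x - s)) * H r (x - s)) * w' (2 * s - x)) x := by
  have hwc : Continuous w := continuous_iff_continuousAt.2 fun x => (hw x).continuousAt
  have hmap : Continuous fun p : ℝ × ℝ => (p.1 - p.2, p.2) := by fun_prop
  have hc1 : Continuous fun p : ℝ × ℝ =>
      (∫ r in (0 : ℝ)..p.1 - p.2, q (r + p.2) * H r p.2) * w (p.1 - 2 * p.2) :=
    ((continuous_goursatInner hq h.1).comp hmap).mul (by fun_prop)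
  have hc2 : Continuous fun p : ℝ × ℝ => q p.1 * (H (p.1 - p.2) p.2 * w (p.1 - 2 * p.2)) :=
    (by fun_prop : Continuous fun p : ℝ × ℝ => q p.1).mul ((h.1.comp hmap).mul (by fun_prop))
  have hc3 : Continuous fun p : ℝ × ℝ =>
      (∫ r in (0 : ℝ)..p.1 - p.2, q (r + p.2) * H r p.2) * w' (p.1 - 2 * p.2) :=
    ((continuous_goursatInner hq h.1).comp hmap).mul (by fun_prop)
  have hx : Continuous fun s : ℝ => (x, s) := by fun_prop
  have key := hasDerivAt_integral_upper
    (F := fun x s => (∫ r in (0 : ℝ)..x - s, q (r + s) * H r s) * w (x - 2 * s))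
    (F' := fun x s => q x * (H (x - s) s * w (x - 2 * s)) +
      (∫ r in (0 : ℝ)..x - s, q (r + s) * H r s) * w' (x - 2 * s)) hc1 (hc2.add hc3)
    (fun x s => by
      have h1 := (h.hasDerivAt_fst_deriv hq (x - s) s).comp_sub_const x s
      have h2 := (hw (x - 2 * s)).comp_sub_const x (2 * s)
      convert! h1.mul h2 using 1
      rw [sub_add_cancel]
      ring) x
  have hflip : ∀ (G : ℝ → ℝ → ℂ) (w : ℝ → ℂ) (x : ℝ),
      ∫ s in (0 : ℝ)..x, G s (x - s) * w (2 * s - x) =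
        ∫ s in (0 : ℝ)..x, G (x - s) s * w (x - 2 * s) := by
    intro G w x
    have := integral_comp_sub_left (a := 0) (b := x)
      (fun s => G (x - s) s * w (x - 2 * s)) x
    rw [sub_self, sub_zero] at this
    rw [← this]
    congr 1 with s
    congr 2 <;> ring_nf
  have hf := hflip (fun s v => ∫ r in (0 : ℝ)..s, q (r + v) * H r v)
  simp only [hf w, hf w', hflip H w]
  have hadd := integral_add (μ := volume) ((hc2.comp hx).intervalIntegrable 0 x)
    ((hc3.comp hx).intervalIntegrable 0 x)
  simp only [Function.comp_def, intervalIntegral.integral_const_mul] at hadd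
  rw [← hadd]
  simpa only [sub_self, integral_same, zero_mul, zero_add] using key

theorem hasDerivAt_characteristicIntegral (h : IsGoursatIntegralSolution q H) (hq : Continuous q)
    {w w' : ℝ → ℂ} (hw : ∀ x, HasDerivAt w (w' x) x) (hw' : Continuous w') (x : ℝ) :
    HasDerivAt (characteristicIntegral H w) ((∫ s in (0 : ℝ)..x, q s) * w x +
      2 * (∫ s in (0 : ℝ)..x,
        (∫ r in (0 : ℝ)..s, q (r + (x - s)) * H r (x - s)) * w (2 * s - x)) -
      characteristicIntegral H w' x) x := by
  have := (h.hasDerivAt_integral_mul hq hw hw' x).const_mul 2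
  convert! this using 1
  rw [h.apply_zero_right, characteristicIntegral]
  ring

/-- In the second derivative the terms (∫₀ˣ q)w' and 2∫H_v w' occur twice with opposite signs, as w
is evaluated at 2s - x in one differentiation and at x - 2s in the other. -/
theorem exists_hasDerivAt_characteristicIntegral (h : IsGoursatIntegralSolution q H)
    (hq : Continuous q) {w w' w'' : ℝ → ℂ} (hw : ∀ x, HasDerivAt w (w' x) x)
    (hw' : ∀ x, HasDerivAt w' (w'' x) x) (hw'' : Continuous w'') :
    ∃ A' : ℝ → ℂ, A' 0 = 0 ∧ (∀ x, HasDerivAt (characteristicIntegral H w) (A' x) x) ∧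
      ∀ x, HasDerivAt A' (q x * w x + q x * characteristicIntegral H w x +
        characteristicIntegral H w'' x) x := by
  have hw'c : Continuous w' := continuous_iff_continuousAt.2 fun x => (hw' x).continuousAt
  refine ⟨_, ?_, h.hasDerivAt_characteristicIntegral hq hw hw'c, fun x => ?_⟩
  · simp [characteristicIntegral]
  · have h1 := (hq.integral_hasStrictDerivAt 0 x).hasDerivAt.mul (hw x)
    have h2 := (h.hasDerivAt_integral_deriv_mul hq hw hw'c x).const_mul 2
    have h3 := h.hasDerivAt_characteristicIntegral hq hw' hw'' x
    convert! (h1.add h2).sub h3 using 1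
    simp only [characteristicIntegral]
    ring

end IsGoursatIntegralSolution

/-! ### Reduction of T_h to T_0. -/

theorem abs_le_of_mem_uIcc_neg {t x : ℝ} (ht : t ∈ uIcc (-x) x) : |t| ≤ |x| := by
  rcases le_total 0 x with h | h
  · rw [uIcc_of_le (by linarith)] at ht
    rw [abs_of_nonneg h]; exact abs_le.2 ht
  · rw [uIcc_of_ge (by linarith)] at ht
    rw [abs_of_nonpos h]; exact abs_le.2 ⟨by linarith [ht.1], ht.2⟩

/-- Integrate by parts against a primitive W of w. The boundary terms vanish, at t = -x because k(s)
- k(-s) is odd; then t ↦ -t turns k(-t)W(t) into k(t)W(-t). -/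
theorem integral_odd_part_mul {k w : ℝ → ℂ} (hk : Continuous k) (hw : Continuous w) (x : ℝ) :
    ∫ t in (-x)..x, (∫ s in t..x, (k s - k (-s))) * w t =
      ∫ t in (-x)..x, k t * ∫ s in (-t)..t, w s := by
  set W : ℝ → ℂ := fun t => ∫ s in (0 : ℝ)..t, w s with hWdef
  have hWd : ∀ t, HasDerivAt W (w t) t := fun t => (hw.integral_hasStrictDerivAt 0 t).hasDerivAt
  have hWc : Continuous W := continuous_iff_continuousAt.2 fun t => (hWd t).continuousAt
  have hkn : Continuous fun s => k (-s) := hk.comp continuous_neg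
  have he : Continuous fun s => k s - k (-s) := hk.sub hkn
  have hDd : ∀ t, HasDerivAt (fun t => ∫ s in t..x, (k s - k (-s))) (-(k t - k (-t))) t :=
    fun t => integral_hasDerivAt_left (he.intervalIntegrable _ _)
      (he.stronglyMeasurableAtFilter _ _) he.continuousAt
  have hzero : ∫ s in (-x)..x, (k s - k (-s)) = 0 := by
    rw [integral_sub (hk.intervalIntegrable _ _) (hkn.intervalIntegrable _ _), integral_comp_neg,
      neg_neg, sub_self]
  rw [integral_mul_deriv_eq_deriv_mul (fun t _ => hDd t) (fun t _ => hWd t)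
    (he.neg.intervalIntegrable _ _) (hw.intervalIntegrable _ _), integral_same, hzero]
  have hflip : ∫ t in (-x)..x, k (-t) * W t = ∫ t in (-x)..x, k t * W (-t) := by
    simpa using integral_comp_neg (a := -x) (b := x) fun t => k t * W (-t)
  have h1 : ∀ t, k t * ∫ s in (-t)..t, w s = k t * W t - k t * W (-t) := fun t => by
    rw [← mul_sub, hWdef, integral_interval_sub_left (hw.intervalIntegrable _ _)
      (hw.intervalIntegrable _ _)]
  simp only [h1, neg_mul, sub_mul, intervalIntegral.integral_neg]
  have hi1 : IntervalIntegrable (fun t => k t * W t) volume (-x) x :=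
    (hk.mul hWc).intervalIntegrable _ _
  have hi2 : IntervalIntegrable (fun t => k (-t) * W t) volume (-x) x :=
    (hkn.mul hWc).intervalIntegrable _ _
  have hi3 : IntervalIntegrable (fun t => k t * W (-t)) volume (-x) x :=
    (hk.mul (hWc.comp continuous_neg)).intervalIntegrable _ _
  rw [integral_sub hi1 hi2, integral_sub hi1 hi3, hflip]
  simp

theorem integral_kernel_mul {k w : ℝ → ℂ} (hk : Continuous k) (hw : Continuous w) (h : ℂ) (x : ℝ) :
    ∫ t in (-x)..x, (h / 2 + k t + h / 2 * ∫ s in t..x, (k s - k (-s))) * w t =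
      h / 2 * (∫ t in (-x)..x, w t) +
        ∫ t in (-x)..x, k t * (w t + h / 2 * ∫ s in (-t)..t, w s) := by
  have he : Continuous fun s => k s - k (-s) := hk.sub (hk.comp continuous_neg)
  have hD : Continuous fun t => ∫ s in t..x, (k s - k (-s)) := by
    simp only [integral_symm x]
    exact (continuous_primitive (fun _ _ => he.intervalIntegrable _ _) x).neg
  have hW : Continuous fun t : ℝ => ∫ s in (-t)..t, w s := by
    have hp : Continuous fun t : ℝ => ∫ s in (0 : ℝ)..t, w s :=
      continuous_primitive (fun _ _ => hw.intervalIntegrable _ _) 0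
    have : (fun t : ℝ => ∫ s in (-t)..t, w s) =
        fun t : ℝ => (∫ s in (0 : ℝ)..t, w s) - ∫ s in (0 : ℝ)..(-t), w s := by
      ext t
      rw [integral_interval_sub_left (hw.intervalIntegrable _ _) (hw.intervalIntegrable _ _)]
    rw [this]
    exact hp.sub (hp.comp continuous_neg)
  have h1 : ∀ t, (h / 2 + k t + h / 2 * ∫ s in t..x, (k s - k (-s))) * w t =
      h / 2 * w t + (k t * w t + h / 2 * ((∫ s in t..x, (k s - k (-s))) * w t)) := fun t => by ring
  have h2 : ∀ t, k t * (w t + h / 2 * ∫ s in (-t)..t, w s) =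
      k t * w t + h / 2 * (k t * ∫ s in (-t)..t, w s) := fun t => by ring
  simp only [h1, h2]
  have hi1 : IntervalIntegrable (fun t => h / 2 * w t) volume (-x) x :=
    (hw.const_mul _).intervalIntegrable _ _
  have hi2 : IntervalIntegrable (fun t => k t * w t) volume (-x) x :=
    (hk.mul hw).intervalIntegrable _ _
  have hi3 : IntervalIntegrable (fun t => h / 2 * ((∫ s in t..x, (k s - k (-s))) * w t))
      volume (-x) x := ((hD.mul hw).const_mul _).intervalIntegrable _ _
  have hi4 : IntervalIntegrable (fun t => h / 2 * (k t * ∫ s in (-t)..t, w s))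
      volume (-x) x := ((hk.mul hW).const_mul _).intervalIntegrable _ _
  rw [integral_add hi1 (hi2.add hi3), integral_add hi2 hi3, integral_add hi2 hi4]
  simp only [intervalIntegral.integral_const_mul, integral_odd_part_mul hk hw]

theorem abs_half_add_abs_half_le {a x t : ℝ} (hx : |x| ≤ a) (ht : |t| ≤ a) :
    |(x + t) / 2| + |(x - t) / 2| ≤ a := by
  obtain ⟨h1, h2⟩ := abs_le.1 hx
  obtain ⟨h3, h4⟩ := abs_le.1 ht
  rcases abs_cases ((x + t) / 2) with h | h <;> rcases abs_cases ((x - t) / 2) with h' | h' <;>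
    linarith

/-- The operator `T_h` applied to `w` is `T_0` applied to `w + (h/2) ∫_{-x}^{x} w`. -/
theorem operatorTh_eq {a : ℝ} {q : ℝ → ℂ} {H : ℝ → ℝ → ℂ}
    (hHc : Continuous fun p : ℝ × ℝ => H p.1 p.2)
    (hH : ∀ u v, |u| + |v| ≤ a → goursatSolution a q u v = H u v) (h : ℂ) {v w : ℝ → ℂ}
    (hw : Continuous w) (hvw : EqOn v w (Icc (-a) a)) {x : ℝ} (hx : x ∈ Icc (-a) a) :
    operatorTh a q h v x = (w x + h / 2 * ∫ s in (-x)..x, w s) +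
      characteristicIntegral H (fun t => w t + h / 2 * ∫ s in (-t)..t, w s) x := by
  have hxa : |x| ≤ a := abs_le.2 hx
  -- The chosen solution is known only on the square; |t| ≤ |x| ≤ a keeps the characteristic
  -- coordinates there.
  have hK : ∀ t, |t| ≤ |x| → kernelK a q x t = H ((x + t) / 2) ((x - t) / 2) := fun t ht =>
    hH _ _ (abs_half_add_abs_half_le hxa (ht.trans hxa))
  have hk : Continuous fun t => H ((x + t) / 2) ((x - t) / 2) :=
    hHc.comp (by fun_prop : Continuous fun t : ℝ => ((x + t) / 2, (x - t) / 2))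
  have hint : ∫ t in (-x)..x, kernelKh a q h x t * v t =
      ∫ t in (-x)..x, (h / 2 + H ((x + t) / 2) ((x - t) / 2) + h / 2 *
        ∫ s in t..x, (H ((x + s) / 2) ((x - s) / 2) - H ((x + -s) / 2) ((x - -s) / 2))) * w t := by
    refine integral_congr fun t ht => ?_
    have htx := abs_le_of_mem_uIcc_neg ht
    have hin : ∫ s in t..x, (kernelK a q x s - kernelK a q x (-s)) =
        ∫ s in t..x, (H ((x + s) / 2) ((x - s) / 2) - H ((x + -s) / 2) ((x - -s) / 2)) := by
      refine integral_congr fun s hs => ?_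
      have hsx : |s| ≤ |x| := abs_le_of_mem_uIcc_neg (uIcc_subset_uIcc ht right_mem_uIcc hs)
      simp only [hK s hsx, hK (-s) (by rwa [abs_neg])]
    simp only [kernelKh, hK t htx, hin, hvw (abs_le.1 (htx.trans hxa))]
  rw [operatorTh, hint, hvw hx,
    integral_kernel_mul (k := fun t => H ((x + t) / 2) ((x - t) / 2)) hk hw,
    ← integral_characteristic, add_assoc]

/-! ### Solutions of the unperturbed equation. -/

theorem eqOn_of_hasDerivWithinAt {a : ℝ} (ha : 0 ≤ a) {f g d : ℝ → ℂ}
    (hf : ∀ x ∈ Icc (-a) a, HasDerivWithinAt f (d x) (Icc (-a) a) x)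
    (hg : ∀ x ∈ Icc (-a) a, HasDerivWithinAt g (d x) (Icc (-a) a) x) (h0 : f 0 = g 0) :
    EqOn f g (Icc (-a) a) := by
  intro x hx
  have := (convex_Icc (-a) a).norm_image_sub_le_of_norm_hasDerivWithin_le (C := 0)
    (fun x hx => (hf x hx).sub (hg x hx)) (fun x _ => by simp)
    (show (0 : ℝ) ∈ Icc (-a) a from ⟨by linarith, ha⟩) hx
  simpa [h0, sub_eq_zero] using this

/-- A solution of `y'' + ω² y = 0` on `[-a, a]` is the restriction of a `C²` function on `ℝ`. -/
theorem IsSchrodingerSolution.exists_extension {a : ℝ} (ha : 0 < a) {ω : ℂ} {v : ℝ → ℂ}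
    (hv : IsSchrodingerSolution a (fun _ => 0) ω v) :
    ∃ w w' w'' : ℝ → ℂ, (∀ x, HasDerivAt w (w' x) x) ∧ (∀ x, HasDerivAt w' (w'' x) x) ∧
      Continuous w'' ∧ EqOn v w (Icc (-a) a) ∧ ∀ x ∈ Icc (-a) a, w'' x = -ω ^ 2 * w x := by
  obtain ⟨v', v'', h⟩ := hv
  have haa : -a ≤ a := by linarith
  have hvc : ContinuousOn v (Icc (-a) a) := fun x hx => (h x hx).1.continuousWithinAt
  -- The equation gives v'' = -ω²v, which is continuous. Extend it by endpoint values and integrate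
  -- twice with the initial data of v at 0.
  have hw'' : Continuous fun x => -ω ^ 2 * IccExtend haa ((Icc (-a) a).domRestrict v) x :=
    continuous_const.mul
      (continuous_IccExtend_iff.2 (continuousOn_iff_continuous_domRestrict.1 hvc))
  set w'' : ℝ → ℂ := fun x => -ω ^ 2 * IccExtend haa ((Icc (-a) a).domRestrict v) x with hw''def
  have hw''v : ∀ x ∈ Icc (-a) a, w'' x = v'' x := by
    intro x hx
    rw [hw''def]
    beta_reduce
    rw [IccExtend_of_mem haa _ hx, domRestrict_apply]
    linear_combination -(h x hx).2.2
  set w' : ℝ → ℂ := fun x => (∫ s in (0 : ℝ)..x, w'' s) + v' 0 with hw'def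
  have hw' : ∀ x, HasDerivAt w' (w'' x) x := fun x =>
    (hw''.integral_hasStrictDerivAt 0 x).hasDerivAt.add_const _
  have hw'c : Continuous w' := continuous_iff_continuousAt.2 fun x => (hw' x).continuousAt
  have hw'v : EqOn w' v' (Icc (-a) a) := eqOn_of_hasDerivWithinAt ha.le
    (fun x _ => (hw' x).hasDerivWithinAt) (fun x hx => hw''v x hx ▸ (h x hx).2.1)
    (by simp [hw'def])
  set w : ℝ → ℂ := fun x => (∫ s in (0 : ℝ)..x, w' s) + v 0 with hwdef
  have hw : ∀ x, HasDerivAt w (w' x) x := fun x =>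
    (hw'c.integral_hasStrictDerivAt 0 x).hasDerivAt.add_const _
  have hwv : EqOn w v (Icc (-a) a) := eqOn_of_hasDerivWithinAt ha.le
    (fun x _ => (hw x).hasDerivWithinAt) (fun x hx => hw'v hx ▸ (h x hx).1)
    (by simp [hwdef])
  refine ⟨w, w', w'', hw, hw', hw'', hwv.symm, fun x hx => ?_⟩
  rw [hwv hx, hw''v x hx]
  linear_combination (h x hx).2.2

theorem characteristicIntegral_congr {H : ℝ → ℝ → ℂ} {w₁ w₂ : ℝ → ℂ} {x : ℝ} {c : ℂ}
    (h : ∀ t, |t| ≤ |x| → w₁ t = c * w₂ t) :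
    characteristicIntegral H w₁ x = c * characteristicIntegral H w₂ x := by
  rw [← integral_characteristic, ← integral_characteristic, ← intervalIntegral.integral_const_mul]
  refine integral_congr fun t ht => ?_
  simp only [h t (abs_le_of_mem_uIcc_neg ht)]
  ring

/-- If `w'' = -ω² w` then `w + (h/2) ∫_{-x}^{x} w` satisfies the same equation. -/
theorem exists_hasDerivAt_add_integral_symm {w w' w'' : ℝ → ℂ} (hw : ∀ x, HasDerivAt w (w' x) x)
    (hw' : ∀ x, HasDerivAt w' (w'' x) x) (hw'' : Continuous w'') (h : ℂ) :
    ∃ y' y'' : ℝ → ℂ, (∀ x, HasDerivAt (fun t => w t + h / 2 * ∫ s in (-t)..t, w s) (y' x) x) ∧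
      (∀ x, HasDerivAt y' (y'' x) x) ∧ Continuous y'' ∧ y' 0 = w' 0 + h * w 0 ∧
      ∀ a : ℝ, ∀ c : ℂ, (∀ x ∈ Icc (-a) a, w'' x = c * w x) → ∀ x ∈ Icc (-a) a,
        y'' x = c * (w x + h / 2 * ∫ s in (-x)..x, w s) := by
  have hwc : Continuous w := continuous_iff_continuousAt.2 fun x => (hw x).continuousAt
  have hw'c : Continuous w' := continuous_iff_continuousAt.2 fun x => (hw' x).continuousAt
  have hneg : ∀ {f f' : ℝ → ℂ}, (∀ x, HasDerivAt f (f' x) x) → ∀ x,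
      HasDerivAt (fun x => f (-x)) (-f' (-x)) x := fun {f f'} hf x => by
    simpa using (show HasDerivAt (fun x => f (-x)) _ x from (hf (-x)).scomp x (hasDerivAt_neg x))
  have hW : ∀ x, HasDerivAt (fun t => ∫ s in (0 : ℝ)..t, w s) (w x) x := fun x =>
    (hwc.integral_hasStrictDerivAt 0 x).hasDerivAt
  have hsplit : ∀ t : ℝ, ∫ s in (-t)..t, w s =
      (∫ s in (0 : ℝ)..t, w s) - ∫ s in (0 : ℝ)..(-t), w s := fun t => by
    rw [integral_interval_sub_left (hwc.intervalIntegrable _ _) (hwc.intervalIntegrable _ _)]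
  refine ⟨fun x => w' x + h / 2 * (w x - -w (-x)), fun x => w'' x + h / 2 * (w' x - - -w' (-x)),
    fun x => ?_, fun x => ?_, by fun_prop, ?_, fun a c hc x hx => ?_⟩
  · simp only [hsplit]
    exact (hw x).add (((hW x).sub (hneg hW x)).const_mul _)
  · exact (hw' x).add (((hw x).sub (hneg hw x).neg).const_mul _)
  · simp only [neg_zero]
    ring
  · have hint : ∫ s in (-x)..x, w'' s = c * ∫ s in (-x)..x, w s := by
      rw [← intervalIntegral.integral_const_mul]
      exact integral_congr fun s hs =>
        hc s (abs_le.1 ((abs_le_of_mem_uIcc_neg hs).trans (abs_le.2 hx)))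
    -- w'(x) - w'(-x), written as w'(x) + (-w'(-x)) inside y'', is ∫ w'' = c∫ w over [-x, x].
    rw [integral_eq_sub_of_hasDerivAt (fun s _ => hw' s) (hw''.intervalIntegrable _ _)] at hint
    simp only [hc x hx]
    linear_combination h / 2 * hint

end

/-! ### The main theorem. -/

theorem mainTheorem10 (a : ℝ) (ha : 0 < a) (q : ℝ → ℂ) (hq : ContinuousOn q (Icc (-a) a)) :
    (IsGoursatSolution a q (goursatSolution a q) ∧
      ∀ H : ℝ → ℝ → ℂ, IsGoursatSolution a q H →
        ∀ u v : ℝ, |u| + |v| ≤ a → H u v = goursatSolution a q u v) ∧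
    ∀ (h ω : ℂ) (v : ℝ → ℂ), IsSchrodingerSolution a (fun _ => 0) ω v →
      IsSchrodingerSolution a q ω (operatorTh a q h v) ∧
      operatorTh a q h v 0 = v 0 ∧
      HasDerivAt (operatorTh a q h v) (deriv v 0 + h * v 0) 0 := by
  obtain ⟨Q, hQ, hQq, M, hM, hQM⟩ := exists_bounded_continuous_extension ha.le hq
  obtain ⟨G, hG⟩ := exists_isGoursatIntegralSolution hM hQ hQM
  have hsol : IsGoursatSolution a q (goursatSolution a q) :=
    Classical.epsilon_spec (p := IsGoursatSolution a q) ⟨G, hG.isGoursatSolution hQ hQq⟩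
  have huniq : ∀ H, IsGoursatSolution a q H → ∀ u v : ℝ, |u| + |v| ≤ a → H u v = G u v :=
    fun H hH u v huv => hH.eq_of_isGoursatIntegralSolution ha hQ hQq hM hQM hG huv
  refine ⟨⟨hsol, fun H hH u v huv => (huniq H hH u v huv).trans (huniq _ hsol u v huv).symm⟩,
    fun h ω v hv => ?_⟩
  obtain ⟨w, w', w'', hw, hw', hw'', hvw, hode⟩ := hv.exists_extension ha
  obtain ⟨y', y'', hy, hy', hy'', hy'0, hyode⟩ :=
    exists_hasDerivAt_add_integral_symm hw hw' hw'' h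
  obtain ⟨A', hA'0, hA, hA'⟩ := hG.exists_hasDerivAt_characteristicIntegral hQ hy hy' hy''
  have hwc : Continuous w := continuous_iff_continuousAt.2 fun x => (hw x).continuousAt
  have h0 : (0 : ℝ) ∈ Icc (-a) a := ⟨by linarith, ha.le⟩
  have hnhds : Icc (-a) a ∈ nhds (0 : ℝ) := Icc_mem_nhds (by linarith) ha
  have hT : ∀ x ∈ Icc (-a) a, operatorTh a q h v x = _ := fun x hx =>
    operatorTh_eq hG.1 (huniq _ hsol) h hwc hvw hx
  have hTd : ∀ x, HasDerivAt _ _ x := fun x => (hy x).add (hA x)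
  refine ⟨⟨_, _, fun x hx => ⟨(hTd x).hasDerivWithinAt.congr_of_mem hT hx,
    ((hy' x).add (hA' x)).hasDerivWithinAt, ?_⟩⟩, ?_, ?_⟩
  -- y'' = -ω²y is known only on [-a, a], which suffices since the integral at x sees only |t| ≤
  -- |x|.
  · have hA'' := characteristicIntegral_congr (H := G) (x := x) (c := -ω ^ 2) fun t ht =>
      hyode a _ hode t (abs_le.1 (ht.trans (abs_le.2 hx)))
    rw [hT x hx, hA'', hyode a _ hode x hx, hQq hx]
    ring
  · rw [hT 0 h0, hvw h0]
    simp [characteristicIntegral]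
  · have hd : deriv v 0 = w' 0 := by
      rw [(hvw.eventuallyEq_of_mem hnhds).deriv_eq, (hw 0).deriv]
    have := (hTd 0).congr_of_eventuallyEq (Filter.eventually_of_mem hnhds hT)
    rwa [hA'0, hy'0, add_zero, ← hd, ← hvw h0] at this
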